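/- Let $V$ be a complex vector space of finite dimension $n$ with a Hermitian inner product $h$ (linear in the first variable), and let $\omega=-\operatorname{Im}h$ be its positive $(1,1)$-form. On the algebra $\bigwedge^*V^*$ of complex-valued forms on $V$ let $\langle\cdot,\cdot\rangle$ be the Hermitian inner product induced by $h$ (linear in the first variable; on one-forms it is the Hermitian extension of the metric dual to $\operatorname{Re}h$, and on decomposable $k$-forms it is given by Gram determinants), let $L=\omega\wedge\cdot$ be the Lefschetz operator, $\Lambda$ its adjoint, and let $\mathbf I=\sum_{p,q}i^{\,p-q}\pi_{p,q}$, where $\pi_{p,q}$ is the projection onto the $(p,q)$-forms. Write $A^{[j]}=A^j/j!$ for $j\ge 0$ and $A^{[j]}=0$ for $j<0$. If $u$ and $v$ are $(p,q)$-forms on $V$ and $k=p+q$, then $$ (-1)^{k(k+1)/2}\, u\wedge\overline{\mathbf I v}\wedge\omega^{[n-k]} =\sum_{m=0}^{n}(-1)^m\,\langle \Lambda^{[m]}u,\Lambda^{[m]}v\rangle\,\omega^{[n]} . $$ -/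

import Mathlib

open Module

noncomputable section

namespace HermitianForms

section Basic

variable (V : Type*) [NormedAddCommGroup V] [InnerProductSpace ℂ V]

/-- Complex-valued one-forms on `V`, i.e. the complexification of the real dual of `V`. -/
abbrev OneForms : Type _ := V →ₗ[ℝ] ℂ

/-- The exterior algebra of complex-valued forms on `V`; the wedge product is multiplication. -/
abbrev Forms : Type _ := ExteriorAlgebra ℂ (OneForms V)

/-- The one-forms of type `(1,0)`: the complex-linear ones. -/
def oneForms10 : Submodule ℂ (OneForms V) where
  carrier := {α | ∀ x : V, α (Complex.I • x) = Complex.I * α x}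
  add_mem' := by
    intro a b ha hb x
    simp only [LinearMap.add_apply, ha x, hb x, mul_add]
  zero_mem' := by intro x; simp
  smul_mem' := by
    intro c a ha x
    simp only [LinearMap.smul_apply, ha x, smul_eq_mul]
    ring

/-- The one-forms of type `(0,1)`: the conjugate-linear ones. -/
def oneForms01 : Submodule ℂ (OneForms V) where
  carrier := {α | ∀ x : V, α (Complex.I • x) = -(Complex.I * α x)}
  add_mem' := by
    intro a b ha hb x
    simp only [LinearMap.add_apply, ha x, hb x, mul_add, neg_add]
  zero_mem' := by intro x; simp
  smul_mem' := by
    intro c a ha x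
    simp only [LinearMap.smul_apply, ha x, smul_eq_mul]
    ring

/-- The `(p,q)`-forms: the span of the wedge products of `p` one-forms of type `(1,0)`
and `q` one-forms of type `(0,1)`. -/
def formsPQ (p q : ℕ) : Submodule ℂ (Forms V) :=
  ((oneForms10 V).map (ExteriorAlgebra.ι ℂ)) ^ p * ((oneForms01 V).map (ExteriorAlgebra.ι ℂ)) ^ q

/-- Pullback of one-forms by multiplication by `i` on `V`. -/
def pullbackI : OneForms V →ₗ[ℂ] OneForms V where
  toFun α := α ∘ₗ (LinearMap.lsmul ℂ V Complex.I).restrictScalars ℝ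
  map_add' _ _ := rfl
  map_smul' _ _ := rfl

/-- The operator `∑ i ^ (p - q) π_{p,q}` on forms. It is pullback by multiplication by `i`;
see `weil_eq_of_mem` for its value `i ^ (p - q) u` on a `(p,q)`-form `u`. -/
def weil : Forms V →ₐ[ℂ] Forms V := ExteriorAlgebra.map (pullbackI V)

/-- The algebra of forms with scalar multiplication twisted by conjugation
(auxiliary, for the definition of the conjugation of forms). -/
def TwistedForms : Type _ := Forms V

instance : Ring (TwistedForms V) := inferInstanceAs (Ring (Forms V))

instance : Algebra ℂ (TwistedForms V) := Algebra.compHom (Forms V) (starRingEnd ℂ)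

variable {V}

/-- Complex conjugation of one-forms. -/
def conjOne (α : OneForms V) : OneForms V := Complex.conjAe.toLinearMap ∘ₗ α

@[simp] lemma conjOne_apply (α : OneForms V) (x : V) :
    conjOne α x = starRingEnd ℂ (α x) := rfl

variable (V) in
/-- Auxiliary to `conjForm`: conjugation on one-forms, as a linear map into the twisted algebra. -/
def conjAux : OneForms V →ₗ[ℂ] TwistedForms V where
  toFun α := (ExteriorAlgebra.ι ℂ (conjOne α) : Forms V)
  map_add' a b := by
    have h : conjOne (a + b) = conjOne a + conjOne b := by ext x; simp
    rw [h]
    exact map_add (ExteriorAlgebra.ι ℂ) _ _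
  map_smul' c a := by
    have h : conjOne (c • a) = (starRingEnd ℂ c) • conjOne a := by ext x; simp
    rw [h]
    exact map_smul (ExteriorAlgebra.ι ℂ) _ _

variable (V) in
/-- Complex conjugation of forms: the ring endomorphism which conjugates one-forms and scalars. -/
def conjForm : Forms V →+* Forms V :=
  (ExteriorAlgebra.lift ℂ ⟨conjAux V, fun a =>
    ExteriorAlgebra.ι_sq_zero (R := ℂ) (conjOne a)⟩ : Forms V →ₐ[ℂ] TwistedForms V).toRingHom

@[simp] lemma conjForm_ι (α : OneForms V) :
    conjForm V (ExteriorAlgebra.ι ℂ α) = ExteriorAlgebra.ι ℂ (conjOne α) :=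
  ExteriorAlgebra.lift_ι_apply (R := ℂ) (A := TwistedForms V) _ _ α

@[simp] lemma conjForm_smul (c : ℂ) (u : Forms V) :
    conjForm V (c • u) = (starRingEnd ℂ c) • conjForm V u :=
  map_smul (ExteriorAlgebra.lift ℂ ⟨conjAux V, fun a =>
    ExteriorAlgebra.ι_sq_zero (R := ℂ) (conjOne a)⟩ : Forms V →ₐ[ℂ] TwistedForms V) c u

lemma conjForm_ιMulti (k : ℕ) (α : Fin k → OneForms V) :
    conjForm V (ExteriorAlgebra.ιMulti ℂ k α) =
      ExteriorAlgebra.ιMulti ℂ k (fun i => conjOne (α i)) := by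
  simp only [ExteriorAlgebra.ιMulti_apply, map_list_prod, List.map_ofFn]
  congr 2
  funext i
  simp

lemma contractLeft_ιMulti (d : Module.Dual ℂ (OneForms V)) (k : ℕ)
    (α : Fin (k + 1) → OneForms V) :
    CliffordAlgebra.contractLeft d (ExteriorAlgebra.ιMulti ℂ (k + 1) α) =
      ∑ i : Fin (k + 1), ((-1 : ℂ) ^ (i : ℕ) * d (α i)) •
        ExteriorAlgebra.ιMulti ℂ k (fun j => α (i.succAbove j)) := by
  induction k with
  | zero =>
    simp [ExteriorAlgebra.ιMulti_apply, ExteriorAlgebra.ι, CliffordAlgebra.contractLeft_ι,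
      Algebra.algebraMap_eq_smul_one]
  | succ k ih =>
    rw [ExteriorAlgebra.ιMulti_succ_apply, ExteriorAlgebra.ι, CliffordAlgebra.contractLeft_ι_mul,
      ih, Fin.sum_univ_succ (n := k + 1), sub_eq_add_neg]
    congr 1
    · simp [Matrix.vecTail, Function.comp_def]
    · rw [Finset.mul_sum, ← Finset.sum_neg_distrib]
      refine Finset.sum_congr rfl fun i _ => ?_
      rw [ExteriorAlgebra.ιMulti_succ_apply, mul_smul_comm, ← neg_smul]
      congr 1
      · simp [Matrix.vecTail, pow_succ]
      · simp [Matrix.vecTail, Function.comp_def, ExteriorAlgebra.ι]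

/-- On `(p,q)`-forms the operator `weil` is multiplication by `i ^ (p - q)`. -/
theorem weil_eq_of_mem {p q : ℕ} {u : Forms V} (hu : u ∈ formsPQ V p q) :
    weil V u = (Complex.I ^ ((p : ℤ) - (q : ℤ))) • u := by
  have key : ∀ (S : Submodule ℂ (OneForms V)) (c : ℂ),
      (∀ α ∈ S, pullbackI V α = c • α) → ∀ (r : ℕ) (w : Forms V),
      w ∈ (S.map (ExteriorAlgebra.ι ℂ)) ^ r → weil V w = (c ^ r) • w := by
    intro S c hS r
    induction r with
    | zero =>
      intro w hw
      rw [pow_zero, Submodule.mem_one] at hw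
      obtain ⟨a, rfl⟩ := hw
      simp
    | succ r ih =>
      intro w hw
      rw [pow_succ] at hw
      induction hw using Submodule.mul_induction_on' with
      | mem_mul_mem a ha b hb =>
        obtain ⟨α, hα, rfl⟩ := hb
        have h1 : weil V (ExteriorAlgebra.ι ℂ α) = c • ExteriorAlgebra.ι ℂ α := by
          rw [weil, ExteriorAlgebra.map_apply_ι, hS α hα, map_smul]
        rw [map_mul, ih a ha, h1, smul_mul_smul_comm, pow_succ]
      | add a _ b _ ha hb => rw [map_add, ha, hb, smul_add]
  have h10 : ∀ α ∈ oneForms10 V, pullbackI V α = Complex.I • α := by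
    intro α hα
    ext x
    exact hα x
  have h01 : ∀ α ∈ oneForms01 V, pullbackI V α = (Complex.I⁻¹ : ℂ) • α := by
    intro α hα
    ext x
    rw [LinearMap.smul_apply, smul_eq_mul, Complex.inv_I, neg_mul]
    exact hα x
  rw [formsPQ] at hu
  induction hu using Submodule.mul_induction_on' with
  | mem_mul_mem a ha b hb =>
    rw [map_mul, key _ _ h10 p a ha, key _ _ h01 q b hb, smul_mul_smul_comm]
    congr 1
    rw [zpow_sub₀ Complex.I_ne_zero, zpow_natCast, zpow_natCast, inv_pow, div_eq_mul_inv]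
  | add a _ b _ ha hb => rw [map_add, ha, hb, smul_add]

end Basic

section DividedPower

variable {A : Type*} [Ring A] [Algebra ℂ A]

/-- The divided power `a ^ j / j!`, which is zero for negative `j`. -/
def dividedPower (a : A) : ℤ → A
  | Int.ofNat j => ((j.factorial : ℂ)⁻¹) • a ^ j
  | Int.negSucc _ => 0

lemma dividedPower_natCast (a : A) (j : ℕ) :
    dividedPower a (j : ℤ) = ((j.factorial : ℂ)⁻¹) • a ^ j := rfl

lemma dividedPower_of_neg (a : A) {j : ℤ} (hj : j < 0) : dividedPower a j = 0 := by
  obtain ⟨m, rfl⟩ := Int.eq_negSucc_of_lt_zero hj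
  rfl

end DividedPower

section Metric

variable (V : Type*) [NormedAddCommGroup V] [InnerProductSpace ℂ V] [FiniteDimensional ℂ V]

/-- The complex-bilinear extension to complex-valued one-forms of the inner product on the
real dual of `V` which is dual to the real part of the Hermitian inner product of `V`.
It is written in the real orthonormal basis `f_j, i f_j` of `V`, where `f_j` is a unitary basis;
see `pairing_riesz` for its independence of the basis. -/
def pairing : OneForms V →ₗ[ℂ] OneForms V →ₗ[ℂ] ℂ :=
  LinearMap.mk₂ ℂ
    (fun α β => ∑ j, (α (stdOrthonormalBasis ℂ V j) * β (stdOrthonormalBasis ℂ V j) +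
      α (Complex.I • stdOrthonormalBasis ℂ V j) * β (Complex.I • stdOrthonormalBasis ℂ V j)))
    (by intro a b c; simp only [LinearMap.add_apply, ← Finset.sum_add_distrib]
        exact Finset.sum_congr rfl fun _ _ => by ring)
    (by intro a b c; simp only [LinearMap.smul_apply, smul_eq_mul, Finset.mul_sum]
        exact Finset.sum_congr rfl fun _ _ => by ring)
    (by intro a b c; simp only [LinearMap.add_apply, ← Finset.sum_add_distrib]
        exact Finset.sum_congr rfl fun _ _ => by ring)
    (by intro a b c; simp only [LinearMap.smul_apply, smul_eq_mul, Finset.mul_sum]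
        exact Finset.sum_congr rfl fun _ _ => by ring)

/-- Contraction of forms by forms, for the metric of `V`: the contraction by a one-form is the
antiderivation extending `pairing`, and the contraction by `a ∧ b` is the contraction by `a`
followed by the contraction by `b`. -/
def contraction : Forms V →ₐ[ℂ] (Module.End ℂ (Forms V))ᵐᵒᵖ :=
  ExteriorAlgebra.lift ℂ
    ⟨(MulOpposite.opLinearEquiv ℂ).toLinearMap ∘ₗ
        (CliffordAlgebra.contractLeft (Q := (0 : QuadraticForm ℂ (OneForms V)))) ∘ₗ pairing V,
      fun a => MulOpposite.unop_injective <| LinearMap.ext fun x =>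
        CliffordAlgebra.contractLeft_contractLeft (pairing V a) x⟩

variable {V}

/-- The Hermitian inner product on forms induced by that of `V`, linear in the first and
conjugate-linear in the second argument; see `formInner_ιMulti` for its values, the Gram
determinants. -/
def formInner (u v : Forms V) : ℂ :=
  ExteriorAlgebra.algebraMapInv ((contraction V (conjForm V v)).unop u)

variable (V)

/-- The unitary coordinates `z_j` on `V`, as one-forms. -/
def coord (j : Fin (finrank ℂ V)) : OneForms V :=
  (innerₛₗ ℂ (stdOrthonormalBasis ℂ V j)).restrictScalars ℝ

/-- The positive `(1,1)`-form `ω = (i / 2) ∑ dz_j ∧ d(conj z_j) = -Im h` of the Hermitian inner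
product `h` of `V`; see `fundamentalForm_apply`. -/
def fundamentalForm : Forms V :=
  (Complex.I / 2) • ∑ j, ExteriorAlgebra.ι ℂ (coord V j) *
    ExteriorAlgebra.ι ℂ (conjOne (coord V j))

/-- The Lefschetz operator `u ↦ ω ∧ u`. -/
def lefschetz : Module.End ℂ (Forms V) := LinearMap.mulLeft ℂ (fundamentalForm V)

/-- The adjoint `Λ` of the Lefschetz operator: the contraction by `ω`;
see `eq_lefschetzAdjoint_iff`. -/
def lefschetzAdjoint : Module.End ℂ (Forms V) := (contraction V (fundamentalForm V)).unop

variable {V}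

/-- The Riesz isomorphism of `V` with its real dual is an isometry for `pairing`. -/
theorem pairing_riesz (x y : V) (α β : OneForms V)
    (hα : ∀ w, α w = ((inner ℂ x w).re : ℂ)) (hβ : ∀ w, β w = ((inner ℂ y w).re : ℂ)) :
    pairing V α β = ((inner ℂ x y).re : ℂ) := by
  rw [← (stdOrthonormalBasis ℂ V).sum_inner_mul_inner x y]
  simp only [pairing, LinearMap.mk₂_apply, hα, hβ, inner_smul_right, Complex.re_sum,
    Complex.ofReal_sum]
  refine Finset.sum_congr rfl fun j _ => ?_
  rw [← inner_conj_symm (𝕜 := ℂ) y (stdOrthonormalBasis ℂ V j)]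
  simp only [Complex.mul_re, Complex.I_re, Complex.I_im, Complex.conj_re, Complex.conj_im]
  push_cast
  ring

/-- Evaluation at a vector, as a functional on one-forms. -/
def evalAt (x : V) : Module.Dual ℂ (OneForms V) where
  toFun α := α x
  map_add' _ _ := rfl
  map_smul' _ _ := rfl

/-- The value of `ω` at the pair `(x, y)` is `- Im h(x, y)`, where `h(x, y) = inner ℂ y x` is
linear in `x`. -/
theorem fundamentalForm_apply (x y : V) :
    CliffordAlgebra.contractLeft (evalAt y)
      (CliffordAlgebra.contractLeft (evalAt x) (fundamentalForm V)) =
      algebraMap ℂ (Forms V) (-((inner ℂ y x).im : ℂ)) := by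
  have hj : ∀ a b : OneForms V, CliffordAlgebra.contractLeft (evalAt y)
      (CliffordAlgebra.contractLeft (evalAt x)
        (ExteriorAlgebra.ι ℂ a * ExteriorAlgebra.ι ℂ b : Forms V)) =
      algebraMap ℂ (Forms V) (a x * b y - a y * b x) := by
    intro a b
    simp only [ExteriorAlgebra.ι]
    rw [CliffordAlgebra.contractLeft_ι_mul, CliffordAlgebra.contractLeft_ι, map_sub, map_smul,
      CliffordAlgebra.contractLeft_ι, ← Algebra.commutes, CliffordAlgebra.contractLeft_algebraMap_mul,
      CliffordAlgebra.contractLeft_ι, map_sub, map_mul, map_mul, Algebra.smul_def]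
    simp only [evalAt, LinearMap.coe_mk, AddHom.coe_mk]
    congr 1
    rw [← map_mul, ← map_mul, mul_comm]
  have h2 : (inner ℂ y x).im = ∑ j, (inner ℂ y (stdOrthonormalBasis ℂ V j) *
      inner ℂ (stdOrthonormalBasis ℂ V j) x).im := by
    rw [← (stdOrthonormalBasis ℂ V).sum_inner_mul_inner y x, Complex.im_sum]
  rw [fundamentalForm, map_smul, map_smul, map_sum, map_sum]
  simp only [hj]
  rw [← map_sum, Algebra.smul_def, ← map_mul, h2]
  congr 1
  rw [Finset.mul_sum, Complex.ofReal_sum, ← Finset.sum_neg_distrib]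
  refine Finset.sum_congr rfl fun j _ => ?_
  simp only [coord, conjOne_apply, LinearMap.coe_restrictScalars, innerₛₗ_apply_apply]
  rw [← inner_conj_symm (𝕜 := ℂ) y (stdOrthonormalBasis ℂ V j)]
  generalize inner ℂ (stdOrthonormalBasis ℂ V j) x = a
  generalize inner ℂ (stdOrthonormalBasis ℂ V j) y = b
  apply Complex.ext <;> simp <;> ring

theorem fundamentalForm_mem : fundamentalForm V ∈ formsPQ V 1 1 := by
  rw [formsPQ, pow_one, pow_one]
  refine Submodule.smul_mem _ _ (Submodule.sum_mem _ fun j _ => Submodule.mul_mem_mul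
    ⟨_, ?_, rfl⟩ ⟨_, ?_, rfl⟩)
  · intro x
    simp [coord]
  · intro x
    simp [coord]

lemma conjForm_fundamentalForm : conjForm V (fundamentalForm V) = fundamentalForm V := by
  have h : ∀ α : OneForms V, conjOne (conjOne α) = α := by intro α; ext x; simp
  have h2 : starRingEnd ℂ (2 : ℂ) = 2 := Complex.conj_ofNat 2
  simp only [fundamentalForm, conjForm_smul, map_sum, map_mul, conjForm_ι, h, map_div₀,
    Complex.conj_I, h2, Finset.smul_sum]
  refine Finset.sum_congr rfl fun j _ => ?_
  rw [eq_neg_of_add_eq_zero_left (ExteriorAlgebra.ι_add_mul_swap (conjOne (coord V j)) (coord V j)),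
    neg_div, neg_smul_neg]

lemma formInner_add_left (u v w : Forms V) :
    formInner (u + v) w = formInner u w + formInner v w := by
  simp [formInner]

lemma formInner_smul_left (c : ℂ) (u w : Forms V) :
    formInner (c • u) w = c * formInner u w := by
  simp [formInner]

lemma formInner_add_right (u v w : Forms V) :
    formInner u (v + w) = formInner u v + formInner u w := by
  simp [formInner]

lemma formInner_smul_right (c : ℂ) (u w : Forms V) :
    formInner u (c • w) = starRingEnd ℂ c * formInner u w := by
  simp [formInner]

lemma contraction_ι (a : OneForms V) (u : Forms V) :
    (contraction V (ExteriorAlgebra.ι ℂ a)).unop u =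
      CliffordAlgebra.contractLeft (pairing V a) u := by
  rw [contraction, ExteriorAlgebra.lift_ι_apply]
  rfl

lemma contraction_mul (a b u : Forms V) :
    (contraction V (a * b)).unop u = (contraction V b).unop ((contraction V a).unop u) := by
  rw [map_mul]
  rfl

lemma contraction_ιMulti_ιMulti (k : ℕ) (α β : Fin k → OneForms V) :
    ExteriorAlgebra.algebraMapInv ((contraction V (ExteriorAlgebra.ιMulti ℂ k β)).unop
      (ExteriorAlgebra.ιMulti ℂ k α)) =
      (Matrix.of fun i j => pairing V (β j) (α i)).det := by
  induction k with
  | zero => simp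
  | succ k ih =>
    rw [ExteriorAlgebra.ιMulti_succ_apply, contraction_mul, contraction_ι, contractLeft_ιMulti,
      Matrix.det_succ_column_zero, map_sum, map_sum]
    refine Finset.sum_congr rfl fun i _ => ?_
    rw [map_smul, map_smul, ih, smul_eq_mul]
    rfl

/-- The inner product of decomposable forms of the same degree is the Gram determinant. -/
theorem formInner_ιMulti (k : ℕ) (α β : Fin k → OneForms V) :
    formInner (ExteriorAlgebra.ιMulti ℂ k α) (ExteriorAlgebra.ιMulti ℂ k β) =
      (Matrix.of fun i j => pairing V (α i) (conjOne (β j))).det := by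
  rw [formInner, conjForm_ιMulti, contraction_ιMulti_ιMulti]
  congr 2
  funext i j
  simp only [pairing, LinearMap.mk₂_apply]
  exact Finset.sum_congr rfl fun _ _ => by ring

/-- Forms of different degrees are orthogonal. -/
theorem formInner_ιMulti_of_ne {k m : ℕ} (h : k ≠ m) (α : Fin k → OneForms V)
    (β : Fin m → OneForms V) :
    formInner (ExteriorAlgebra.ιMulti ℂ k α) (ExteriorAlgebra.ιMulti ℂ m β) = 0 := by
  rw [formInner, conjForm_ιMulti]
  generalize (fun i => conjOne (β i)) = γ
  clear β
  induction m generalizing k with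
  | zero =>
    obtain ⟨k, rfl⟩ := Nat.exists_eq_succ_of_ne_zero h
    rw [ExteriorAlgebra.ιMulti_zero_apply, map_one, MulOpposite.unop_one, Module.End.one_apply,
      ExteriorAlgebra.ιMulti_succ_apply, map_mul]
    simp [ExteriorAlgebra.algebraMapInv]
  | succ m ih =>
    rw [ExteriorAlgebra.ιMulti_succ_apply, contraction_mul, contraction_ι]
    cases k with
    | zero => rw [ExteriorAlgebra.ιMulti_zero_apply, CliffordAlgebra.contractLeft_one, map_zero,
        map_zero]
    | succ k =>
      rw [contractLeft_ιMulti, map_sum, map_sum]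
      refine Finset.sum_eq_zero fun i _ => ?_
      rw [map_smul, map_smul, ih (by omega), smul_zero]

instance : FiniteDimensional ℂ (OneForms V) :=
  haveI : FiniteDimensional ℝ V := FiniteDimensional.complexToReal V
  Module.Finite.of_restrictScalars_finite ℝ ℂ (OneForms V)

lemma pairing_conj_self (α : OneForms V) :
    pairing V α (conjOne α) = ((∑ j, (‖α (stdOrthonormalBasis ℂ V j)‖ ^ 2 +
      ‖α (Complex.I • stdOrthonormalBasis ℂ V j)‖ ^ 2) : ℝ) : ℂ) := by
  simp only [pairing, LinearMap.mk₂_apply, conjOne_apply, Complex.mul_conj,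
    Complex.normSq_eq_norm_sq]
  push_cast
  rfl

/-- The Hermitian inner product on one-forms, in Mathlib's convention. -/
@[reducible] def oneFormCore : InnerProductSpace.Core ℂ (OneForms V) where
  inner α β := pairing V β (conjOne α)
  conj_inner_symm α β := by
    simp only [pairing, LinearMap.mk₂_apply, map_sum, map_add, map_mul, conjOne_apply,
      Complex.conj_conj]
    exact Finset.sum_congr rfl fun _ _ => by ring
  re_inner_nonneg α := by
    rw [pairing_conj_self]
    simp only [RCLike.re_to_complex, Complex.ofReal_re]
    positivity
  add_left α β γ := by
    have h : conjOne (α + β) = conjOne α + conjOne β := by ext x; simp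
    rw [h, map_add]
  smul_left α β c := by
    have h : conjOne (c • α) = (starRingEnd ℂ c) • conjOne α := by ext x; simp
    rw [h, map_smul, smul_eq_mul]
  definite α h := by
    rw [pairing_conj_self, Complex.ofReal_eq_zero,
      Finset.sum_eq_zero_iff_of_nonneg (fun _ _ => by positivity)] at h
    have h1 : ∀ j, α (stdOrthonormalBasis ℂ V j) = 0 ∧
        α (Complex.I • stdOrthonormalBasis ℂ V j) = 0 := by
      intro j
      have := h j (Finset.mem_univ j)
      have h2 := sq_nonneg ‖α (stdOrthonormalBasis ℂ V j)‖
      have h3 := sq_nonneg ‖α (Complex.I • stdOrthonormalBasis ℂ V j)‖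
      constructor
      · rw [← norm_eq_zero, ← sq_eq_zero_iff]; linarith
      · rw [← norm_eq_zero, ← sq_eq_zero_iff]; linarith
    ext x
    rw [← (stdOrthonormalBasis ℂ V).sum_repr x, map_sum, LinearMap.zero_apply]
    refine Finset.sum_eq_zero fun j _ => ?_
    generalize (stdOrthonormalBasis ℂ V).repr x j = c
    have : c • stdOrthonormalBasis ℂ V j = c.re • stdOrthonormalBasis ℂ V j +
        c.im • (Complex.I • stdOrthonormalBasis ℂ V j) := by
      conv_lhs => rw [← Complex.re_add_im c]
      rw [add_smul, mul_smul, Complex.coe_smul, Complex.coe_smul]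
    rw [this, map_add, map_smul, map_smul, (h1 j).1, (h1 j).2, smul_zero, smul_zero, add_zero]

variable (V) in
/-- There are orthonormal bases of the space of one-forms. -/
lemma exists_orthonormal_basis : ∃ (N : ℕ) (b : Basis (Fin N) ℂ (OneForms V)),
    ∀ i j, pairing V (b i) (conjOne (b j)) = if i = j then 1 else 0 := by
  let _ : NormedAddCommGroup (OneForms V) := (oneFormCore (V := V)).toNormedAddCommGroup
  let _ : InnerProductSpace ℂ (OneForms V) := InnerProductSpace.ofCore oneFormCore.toCore
  refine ⟨_, (stdOrthonormalBasis ℂ (OneForms V)).toBasis, fun i j => ?_⟩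
  have h := orthonormal_iff_ite.1 (stdOrthonormalBasis ℂ (OneForms V)).orthonormal j i
  rw [OrthonormalBasis.coe_toBasis]
  simp only [eq_comm (a := i)]
  exact h

variable (V) in
/-- In a suitable basis of the space of forms, `formInner` is the standard Hermitian
inner product. -/
lemma exists_basis_formInner : ∃ (N : ℕ) (b : Basis (Finset (Fin N)) ℂ (Forms V)),
    ∀ u v, formInner u v = ∑ s, b.repr u s * starRingEnd ℂ (b.repr v s) := by
  obtain ⟨N, b, hb⟩ := exists_orthonormal_basis V
  have hs : ∀ s t : Finset (Fin N), formInner (b.ExteriorAlgebra s) (b.ExteriorAlgebra t) =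
      if s = t then 1 else 0 := by
    intro s t
    by_cases hc : s.card = t.card
    · rw [ExteriorAlgebra.basis_apply_ofCard b (n := t.card) hc,
        ExteriorAlgebra.basis_apply_ofCard b (n := t.card) (s := t) rfl]
      simp only [ExteriorAlgebra.ιMulti_family, formInner_ιMulti]
      split_ifs with h
      · subst h
        rw [show (Matrix.of fun i j => _) = (1 : Matrix (Fin s.card) (Fin s.card) ℂ) from ?_,
          Matrix.det_one]
        ext i j
        simp [hb, Matrix.one_apply]
      · obtain ⟨x, hxs, hxt⟩ : ∃ x ∈ s, x ∉ t := by
          by_contra! hc'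
          exact h (Finset.eq_of_subset_of_card_le hc' hc.ge)
        obtain ⟨i, hi⟩ := (Set.powersetCard.mem_range_ofFinEmbEquiv_symm_iff_mem
          (Set.powersetCard.ofCard hc) x).2 hxs
        refine Matrix.det_eq_zero_of_row_eq_zero i fun j => ?_
        rw [Matrix.of_apply, Function.comp_apply, Function.comp_apply, hb, hi]
        refine if_neg fun hx => hxt ?_
        rw [hx]
        exact (Set.powersetCard.mem_range_ofFinEmbEquiv_symm_iff_mem
          (Set.powersetCard.ofCard (s := t) rfl) _).1 ⟨j, rfl⟩
    · have hne : s ≠ t := fun h => hc (h ▸ rfl)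
      rw [ExteriorAlgebra.basis_apply, ExteriorAlgebra.basis_apply, if_neg hne]
      exact formInner_ιMulti_of_ne hc _ _
  refine ⟨N, b.ExteriorAlgebra, fun u v => ?_⟩
  have hl : ∀ w, formInner u w = ∑ s, b.ExteriorAlgebra.repr u s *
      formInner (b.ExteriorAlgebra s) w := by
    intro w
    let F : Forms V →ₗ[ℂ] ℂ :=
      ⟨⟨fun u => formInner u w, fun a c => formInner_add_left a c w⟩,
        fun c a => formInner_smul_left c a w⟩
    have : F u = F (∑ s, b.ExteriorAlgebra.repr u s • b.ExteriorAlgebra s) := by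
      rw [b.ExteriorAlgebra.sum_repr]
    rw [map_sum] at this
    simpa [F, formInner_smul_left] using this
  have hr : ∀ s, formInner (b.ExteriorAlgebra s) v =
      starRingEnd ℂ (b.ExteriorAlgebra.repr v s) := by
    intro s
    let F : Forms V →ₛₗ[starRingEnd ℂ] ℂ :=
      ⟨⟨fun v => formInner (b.ExteriorAlgebra s) v, fun a c => formInner_add_right _ a c⟩,
        fun c a => formInner_smul_right c _ a⟩
    have : F v = F (∑ t, b.ExteriorAlgebra.repr v t • b.ExteriorAlgebra t) := by
      rw [b.ExteriorAlgebra.sum_repr]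
    rw [map_sum] at this
    simpa [F, formInner_smul_right, hs] using this
  rw [hl]
  exact Finset.sum_congr rfl fun s _ => by rw [hr]

/-- `formInner` is Hermitian. -/
theorem formInner_conj_symm (u v : Forms V) :
    starRingEnd ℂ (formInner v u) = formInner u v := by
  obtain ⟨N, b, hb⟩ := exists_basis_formInner V
  simp only [hb, map_sum, map_mul, Complex.conj_conj]
  exact Finset.sum_congr rfl fun _ _ => mul_comm _ _

/-- `formInner` is positive definite. -/
theorem formInner_self_pos {u : Forms V} (hu : u ≠ 0) :
    0 < (formInner u u).re ∧ (formInner u u).im = 0 := by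
  obtain ⟨N, b, hb⟩ := exists_basis_formInner V
  have h : formInner u u = ((∑ s, ‖b.repr u s‖ ^ 2 : ℝ) : ℂ) := by
    rw [hb]
    push_cast
    exact Finset.sum_congr rfl fun s _ => by rw [Complex.mul_conj, Complex.normSq_eq_norm_sq]; simp
  rw [h, Complex.ofReal_re, Complex.ofReal_im]
  refine ⟨?_, rfl⟩
  obtain ⟨s, hs⟩ : ∃ s, b.repr u s ≠ 0 := by
    by_contra! hc
    exact hu (b.ext_elem fun s => by simp [hc])
  exact Finset.sum_pos' (fun _ _ => by positivity) ⟨s, Finset.mem_univ s, by positivity⟩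

/-- `lefschetzAdjoint` is the adjoint of the Lefschetz operator. -/
theorem eq_lefschetzAdjoint_iff (T : Module.End ℂ (Forms V)) :
    T = lefschetzAdjoint V ↔ ∀ u v, formInner (lefschetz V u) v = formInner u (T v) := by
  have key : ∀ u v, formInner (lefschetz V u) v = formInner u (lefschetzAdjoint V v) := by
    intro u v
    rw [← formInner_conj_symm, ← formInner_conj_symm u]
    congr 1
    simp only [formInner, lefschetz, LinearMap.mulLeft_apply, map_mul, conjForm_fundamentalForm]
    rfl
  constructor
  · rintro rfl
    exact key
  · intro h
    refine LinearMap.ext fun v => ?_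
    by_contra hne
    have h0 : T v - lefschetzAdjoint V v ≠ 0 := sub_ne_zero.2 hne
    have h1 := (formInner_self_pos h0).1
    generalize hw : T v - lefschetzAdjoint V v = w at h1
    have h2 : formInner w w = formInner w (T v) + (-1) * formInner w (lefschetzAdjoint V v) := by
      have h3 : w = T v + (-1 : ℂ) • lefschetzAdjoint V v := by rw [← hw]; module
      conv_lhs => rw [h3, ← h3]
      conv_lhs => arg 2; rw [h3]
      rw [formInner_add_right, formInner_smul_right]
      simp
    rw [← h, ← key] at h2
    rw [h2] at h1
    simp at h1

end Metric

end HermitianForms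

end

/-! Write `J` for `pullbackI`, `i_a` for contraction by the metric dual of a one-form `a`, and `exp
Λ` for the sum of the `Λ^[m]`. The identity compares two ways of contracting `u ∧ conj (I v)`
completely by `ω`.

On one side, a form `x` of degree `2k` satisfies `x ∧ ω^[n-k] = (Λ^[k] x) ω^[n]`
(`mul_dividedPower_fundamentalForm`), where `Λ^[k] x` is a scalar. The left side of the theorem is
therefore the scalar part of `exp Λ (u ∧ conj (I v))`, up to sign, times `ω^[n]`.

On the other side, a Wick formula (`algebraMapInv_expAdjoint_mul_weil`) evaluates this scalar.
Contracting a product by `ω` means contracting within each factor, which gives `exp Λ u` and `exp Λ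
w`, and then pairing the two factors with each other. Because `J² = -1`, the twist by `I` turns the
cross pairings by `ω` into metric pairings, up to a sign -1 for each pair. With `w = conj v` the
cross pairing of `Λ^[m] u` with `Λ^[m] v` is `formInner` up to a sign that depends on the degree `k
- 2m` (`negContraction_eq_contraction`). Terms of different degrees are orthogonal, and the signs
combine to `(-1)^m`.

Both sides rest on two relations: `i_a ω = -J a` (`intProd_fundamentalForm`) and `[Λ, b ∧ ·] = -i_{J
b}` (`lefschetzAdjoint_ι_mul`). Since `i_{J b}` commutes with `Λ`, the second one exponentiates
without higher terms (`expAdjoint_ι_mul`), which makes induction on one-form factors possible. -/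

open Module

noncomputable section

namespace HermitianForms

/-! ### Degrees, the grade involution, and real operators on forms. -/

section GradeInvolution

variable {V : Type*} [NormedAddCommGroup V] [InnerProductSpace ℂ V]

lemma forms_induction {P : Forms V → Prop} (algebraMap : ∀ r : ℂ, P (algebraMap ℂ (Forms V) r))
    (add : ∀ x y, P x → P y → P (x + y))
    (ι_mul : ∀ a x, P x → P (ExteriorAlgebra.ι ℂ a * x)) (x : Forms V) : P x :=
  CliffordAlgebra.left_induction (Q := (0 : QuadraticForm ℂ (OneForms V))) (P := P)
    algebraMap add (fun x a => ι_mul a x) x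

variable (V) in
/-- The grade involution, which is `(-1) ^ k` on forms of degree `k`. -/
def gradeInvolution : Forms V →ₐ[ℂ] Forms V := ExteriorAlgebra.map (-LinearMap.id)

@[simp] lemma gradeInvolution_ι (a : OneForms V) :
    gradeInvolution V (ExteriorAlgebra.ι ℂ a) = -ExteriorAlgebra.ι ℂ a := by
  simp [gradeInvolution]

@[simp] lemma gradeInvolution_gradeInvolution (x : Forms V) :
    gradeInvolution V (gradeInvolution V x) = x := by
  induction x using forms_induction with
  | algebraMap r => simp
  | add x y hx hy => simp [hx, hy]
  | ι_mul a x hx => simp [hx]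

@[simp] lemma algebraMapInv_ι_mul (a : OneForms V) (x : Forms V) :
    ExteriorAlgebra.algebraMapInv (ExteriorAlgebra.ι ℂ a * x) = (0 : ℂ) := by
  simp [ExteriorAlgebra.algebraMapInv]

@[simp] lemma algebraMapInv_gradeInvolution (x : Forms V) :
    ExteriorAlgebra.algebraMapInv (gradeInvolution V x) = ExteriorAlgebra.algebraMapInv x := by
  induction x using forms_induction with
  | algebraMap r => simp
  | add x y hx hy => simp [hx, hy]
  | ι_mul a x hx => simp

lemma mul_ι_eq (x : Forms V) (a : OneForms V) :
    x * ExteriorAlgebra.ι ℂ a = ExteriorAlgebra.ι ℂ a * gradeInvolution V x := by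
  induction x using forms_induction with
  | algebraMap r => rw [AlgHom.commutes, Algebra.commutes]
  | add x y hx hy => rw [add_mul, hx, hy, map_add, mul_add]
  | ι_mul b x hx =>
    rw [mul_assoc, hx, map_mul, gradeInvolution_ι, ← mul_assoc, ← mul_assoc,
      eq_neg_of_add_eq_zero_left (ExteriorAlgebra.ι_add_mul_swap b a)]
    simp

lemma mem_exteriorPower_ι_mul (a : OneForms V) {r : ℕ} {x : Forms V}
    (hx : x ∈ ⋀[ℂ]^r (OneForms V)) :
    ExteriorAlgebra.ι ℂ a * x ∈ ⋀[ℂ]^(r + 1) (OneForms V) := by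
  rw [ExteriorAlgebra.exteriorPower, pow_succ']
  exact Submodule.mul_mem_mul ⟨a, rfl⟩ hx

lemma mem_exteriorPower_mul {r s : ℕ} {x y : Forms V} (hx : x ∈ ⋀[ℂ]^r (OneForms V))
    (hy : y ∈ ⋀[ℂ]^s (OneForms V)) : x * y ∈ ⋀[ℂ]^(r + s) (OneForms V) := by
  rw [ExteriorAlgebra.exteriorPower, pow_add]
  exact Submodule.mul_mem_mul hx hy

lemma algebraMap_mem_exteriorPower_zero (c : ℂ) :
    algebraMap ℂ (Forms V) c ∈ ⋀[ℂ]^0 (OneForms V) := by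
  rw [ExteriorAlgebra.exteriorPower, pow_zero]
  exact Submodule.algebraMap_mem c

@[elab_as_elim]
lemma exteriorPower_induction {P : (r : ℕ) → (x : Forms V) → x ∈ ⋀[ℂ]^r (OneForms V) → Prop}
    (algebraMap : ∀ c : ℂ, P 0 (algebraMap ℂ (Forms V) c) (algebraMap_mem_exteriorPower_zero c))
    (add : ∀ r x y hx hy, P r x hx → P r y hy → P r (x + y) (add_mem hx hy))
    (ι_mul : ∀ a r x hx, P r x hx →
      P (r + 1) (ExteriorAlgebra.ι ℂ a * x) (mem_exteriorPower_ι_mul a hx))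
    {r : ℕ} {x : Forms V} (hx : x ∈ ⋀[ℂ]^r (OneForms V)) : P r x hx := by
  induction hx using Submodule.pow_induction_on_left' with
  | algebraMap c => exact algebraMap c
  | add x y r hx hy ihx ihy => exact add r x y hx hy ihx ihy
  | mem_mul m hm r x hx ih =>
    obtain ⟨a, rfl⟩ := hm
    exact ι_mul a r x hx ih

lemma gradeInvolution_of_mem {r : ℕ} {x : Forms V} (hx : x ∈ ⋀[ℂ]^r (OneForms V)) :
    gradeInvolution V x = (-1 : ℂ) ^ r • x := by
  induction hx using exteriorPower_induction with
  | algebraMap c => simp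
  | add r x y _ _ hx hy => simp [hx, hy]
  | ι_mul a r x _ hx => simp [hx, pow_succ]

lemma algebraMapInv_eq_zero {r : ℕ} (hr : r ≠ 0) {x : Forms V}
    (hx : x ∈ ⋀[ℂ]^r (OneForms V)) : (ExteriorAlgebra.algebraMapInv x : ℂ) = 0 := by
  induction hx using exteriorPower_induction with
  | algebraMap c => exact absurd rfl hr
  | add r x y _ _ hx hy => rw [map_add, hx hr, hy hr, add_zero]
  | ι_mul a r x _ _ => exact algebraMapInv_ι_mul a x

lemma weil_ι (a : OneForms V) :
    weil V (ExteriorAlgebra.ι ℂ a) = ExteriorAlgebra.ι ℂ (pullbackI V a) := by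
  rw [weil, ExteriorAlgebra.map_apply_ι]

lemma pullbackI_pullbackI (a : OneForms V) : pullbackI V (pullbackI V a) = -a := by
  ext x
  simp [pullbackI, smul_smul]

lemma conjOne_pullbackI (a : OneForms V) :
    conjOne (pullbackI V a) = pullbackI V (conjOne a) := rfl

lemma conjForm_algebraMap (c : ℂ) : conjForm V (algebraMap ℂ (Forms V) c) =
    algebraMap ℂ (Forms V) (starRingEnd ℂ c) := by
  rw [Algebra.algebraMap_eq_smul_one, conjForm_smul, map_one, Algebra.algebraMap_eq_smul_one]

/-- `J` acts on the argument of a one-form and conjugation on its value. This puts `conj (I v)` in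
the shape `I w` with `w = conj v`, as Wick's formula requires. -/
lemma conjForm_weil (x : Forms V) : conjForm V (weil V x) = weil V (conjForm V x) := by
  induction x using forms_induction with
  | algebraMap r => simp [conjForm_algebraMap]
  | add x y hx hy => simp [hx, hy]
  | ι_mul a x hx => simp [hx, weil_ι, conjOne_pullbackI]

lemma weil_mem_exteriorPower {r : ℕ} {x : Forms V} (hx : x ∈ ⋀[ℂ]^r (OneForms V)) :
    weil V x ∈ ⋀[ℂ]^r (OneForms V) := by
  induction hx using exteriorPower_induction with
  | algebraMap c => simp
  | add r x y _ _ hx hy => rw [map_add]; exact add_mem hx hy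
  | ι_mul a r x _ hx => rw [map_mul, weil_ι]; exact mem_exteriorPower_ι_mul _ hx

lemma conjForm_mem_exteriorPower {r : ℕ} {x : Forms V} (hx : x ∈ ⋀[ℂ]^r (OneForms V)) :
    conjForm V x ∈ ⋀[ℂ]^r (OneForms V) := by
  induction hx using exteriorPower_induction with
  | algebraMap c => simp [conjForm_algebraMap]
  | add r x y _ _ hx hy => rw [map_add]; exact add_mem hx hy
  | ι_mul a r x _ hx => rw [map_mul, conjForm_ι]; exact mem_exteriorPower_ι_mul _ hx

lemma formsPQ_le_exteriorPower (p q : ℕ) : formsPQ V p q ≤ ⋀[ℂ]^(p + q) (OneForms V) := by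
  rw [formsPQ, ExteriorAlgebra.exteriorPower, pow_add]
  exact mul_le_mul' (pow_le_pow_left' LinearMap.map_le_range p)
    (pow_le_pow_left' LinearMap.map_le_range q)

lemma dividedPower_succ {A : Type*} [Ring A] [Algebra ℂ A] (a : A) (m : ℕ) :
    dividedPower a ((m + 1 : ℕ) : ℤ) = ((m + 1 : ℂ)⁻¹) • (a * dividedPower a (m : ℤ)) := by
  rw [dividedPower_natCast, dividedPower_natCast, mul_smul_comm, smul_smul, pow_succ',
    Nat.factorial_succ]
  push_cast
  rw [mul_inv]

@[simp] lemma dividedPower_zero {A : Type*} [Ring A] [Algebra ℂ A] (a : A) :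
    dividedPower a 0 = 1 := by
  simpa using dividedPower_natCast a 0

end GradeInvolution

/-! ### Contractions, `Λ` in unitary coordinates, and its commutator with one-forms. -/

section Contraction

variable {V : Type*} [NormedAddCommGroup V] [InnerProductSpace ℂ V] [FiniteDimensional ℂ V]

/-- The complex-valued one-forms have complex dimension equal to the real dimension of `V`, namely
`2n`. -/
lemma exteriorPower_eq_zero {r : ℕ} (hr : 2 * finrank ℂ V < r) {x : Forms V}
    (hx : x ∈ ⋀[ℂ]^r (OneForms V)) : x = 0 := by
  have : FiniteDimensional ℝ V := FiniteDimensional.complexToReal V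
  have h : finrank ℂ (OneForms V) = 2 * finrank ℂ V := by
    rw [finrank_linearMap_self, finrank_real_of_complex]
  have h1 := exteriorPower.finrank_eq (R := ℂ) (M := OneForms V) (n := r)
  rw [h, Nat.choose_eq_zero_of_lt hr] at h1
  have h2 := Submodule.finrank_eq_zero.1 h1
  rw [h2] at hx
  exact (Submodule.mem_bot ℂ).1 hx

/-- Contraction by the metric dual of a one-form. -/
def intProd (a : OneForms V) : Module.End ℂ (Forms V) :=
  CliffordAlgebra.contractLeft (pairing V a)

lemma intProd_ι_mul (a b : OneForms V) (x : Forms V) :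
    intProd a (ExteriorAlgebra.ι ℂ b * x) =
      pairing V a b • x - ExteriorAlgebra.ι ℂ b * intProd a x :=
  CliffordAlgebra.contractLeft_ι_mul (pairing V a) b x

@[simp] lemma intProd_algebraMap (a : OneForms V) (c : ℂ) :
    intProd a (algebraMap ℂ (Forms V) c) = 0 :=
  CliffordAlgebra.contractLeft_algebraMap _ (pairing V a) c

lemma intProd_ι (a b : OneForms V) :
    intProd a (ExteriorAlgebra.ι ℂ b) = algebraMap ℂ (Forms V) (pairing V a b) :=
  CliffordAlgebra.contractLeft_ι _ (pairing V a) b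

lemma intProd_comm (a b : OneForms V) (x : Forms V) :
    intProd a (intProd b x) = -intProd b (intProd a x) :=
  CliffordAlgebra.contractLeft_comm (pairing V a) (pairing V b) x

lemma intProd_add (a b : OneForms V) : intProd (a + b) = intProd a + intProd b := by
  simp [intProd]

lemma intProd_smul (c : ℂ) (a : OneForms V) : intProd (c • a) = c • intProd a := by
  simp [intProd]

lemma intProd_neg (a : OneForms V) : intProd (-a) = -intProd a := by
  simp [intProd]

lemma intProd_sum {ι : Type*} (s : Finset ι) (a : ι → OneForms V) :
    intProd (∑ j ∈ s, a j) = ∑ j ∈ s, intProd (a j) := by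
  simp [intProd]

lemma intProd_gradeInvolution (a : OneForms V) (x : Forms V) :
    intProd a (gradeInvolution V x) = -gradeInvolution V (intProd a x) := by
  induction x using forms_induction with
  | algebraMap r => simp
  | add x y hx hy => rw [map_add, map_add, hx, hy, map_add, map_add, neg_add]
  | ι_mul b x hx =>
    simp [intProd_ι_mul, hx]

lemma intProd_mul (a : OneForms V) (x y : Forms V) :
    intProd a (x * y) = intProd a x * y + gradeInvolution V x * intProd a y := by
  induction x using forms_induction with
  | algebraMap r => simp [← Algebra.smul_def]
  | add x y hx hy => simp only [add_mul, map_add, hx, hy]; abel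
  | ι_mul b x hx =>
    simp only [mul_assoc, intProd_ι_mul, hx, map_mul, gradeInvolution_ι, sub_mul, mul_add,
      smul_mul_assoc, neg_mul]
    abel

/-- Degree zero and positive degree are proved together because the induction step for degree one
needs the vanishing in degree zero; truncated subtraction of degrees is thus avoided. -/
lemma intProd_mem (a : OneForms V) {r : ℕ} {x : Forms V} (hx : x ∈ ⋀[ℂ]^r (OneForms V)) :
    (r = 0 → intProd a x = 0) ∧ ∀ s, r = s + 1 → intProd a x ∈ ⋀[ℂ]^s (OneForms V) := by
  induction hx using exteriorPower_induction with
  | algebraMap c => simp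
  | add r x y _ _ hx hy =>
    refine ⟨fun h => by rw [map_add, hx.1 h, hy.1 h, add_zero], fun s h => ?_⟩
    rw [map_add]
    exact add_mem (hx.2 s h) (hy.2 s h)
  | ι_mul b r x hm hx =>
    refine ⟨fun h => absurd h (Nat.succ_ne_zero r), fun s h => ?_⟩
    obtain rfl : r = s := Nat.succ_injective h
    rw [intProd_ι_mul]
    refine sub_mem (Submodule.smul_mem _ _ hm) ?_
    cases r with
    | zero => rw [hx.1 rfl, mul_zero]; exact zero_mem _
    | succ r => exact mem_exteriorPower_ι_mul b (hx.2 r rfl)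

lemma intProd_mem_exteriorPower (a : OneForms V) {r : ℕ} {x : Forms V}
    (hx : x ∈ ⋀[ℂ]^(r + 1) (OneForms V)) : intProd a x ∈ ⋀[ℂ]^r (OneForms V) :=
  (intProd_mem a hx).2 r rfl

lemma intProd_eq_zero (a : OneForms V) {x : Forms V} (hx : x ∈ ⋀[ℂ]^0 (OneForms V)) :
    intProd a x = 0 :=
  (intProd_mem a hx).1 rfl

lemma fundamentalForm_mem_exteriorPower : fundamentalForm V ∈ ⋀[ℂ]^2 (OneForms V) :=
  formsPQ_le_exteriorPower 1 1 fundamentalForm_mem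

lemma gradeInvolution_fundamentalForm :
    gradeInvolution V (fundamentalForm V) = fundamentalForm V := by
  simp [gradeInvolution_of_mem fundamentalForm_mem_exteriorPower]

lemma pairing_comm (a b : OneForms V) : pairing V a b = pairing V b a := by
  simp only [pairing, LinearMap.mk₂_apply]
  exact Finset.sum_congr rfl fun _ _ => by ring

lemma pairing_conjOne (a b : OneForms V) :
    pairing V (conjOne a) (conjOne b) = starRingEnd ℂ (pairing V a b) := by
  simp [pairing]

/-- The metric dual of `dz_j` is `e_j + i (J e_j)` in the complexification of `V`, that is, twice
the antiholomorphic coordinate vector. -/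
lemma pairing_coord (b : OneForms V) (j : Fin (finrank ℂ V)) :
    pairing V (coord V j) b = b (stdOrthonormalBasis ℂ V j) +
      Complex.I * b (Complex.I • stdOrthonormalBasis ℂ V j) := by
  simp only [pairing, LinearMap.mk₂_apply, coord, LinearMap.coe_restrictScalars,
    innerₛₗ_apply_apply, inner_smul_right,
    orthonormal_iff_ite.1 (stdOrthonormalBasis ℂ V).orthonormal]
  simp [Finset.sum_add_distrib]

lemma pairing_conjOne_coord (b : OneForms V) (j : Fin (finrank ℂ V)) :
    pairing V (conjOne (coord V j)) b = b (stdOrthonormalBasis ℂ V j) -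
      Complex.I * b (Complex.I • stdOrthonormalBasis ℂ V j) := by
  simp only [pairing, LinearMap.mk₂_apply, coord, LinearMap.coe_restrictScalars, conjOne_apply,
    innerₛₗ_apply_apply, inner_smul_right,
    orthonormal_iff_ite.1 (stdOrthonormalBasis ℂ V).orthonormal]
  simp [Finset.sum_add_distrib, sub_eq_add_neg, apply_ite (starRingEnd ℂ)]

/-- The contraction of the fundamental form by a one-form, in coordinates. -/
lemma pullbackI_eq_sum (b : OneForms V) :
    -pullbackI V b = (Complex.I / 2) • ∑ j, (pairing V (coord V j) b • conjOne (coord V j) -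
      pairing V (conjOne (coord V j)) b • coord V j) := by
  ext x
  -- `b` is only real-linear, so `i x` is expanded in the real basis `e_j`, `i e_j`, using `i c =
  -- -Im c + i Re c` for each coordinate `c`.
  have hx : Complex.I • x = ∑ j, ((inner ℂ (stdOrthonormalBasis ℂ V j) x).re •
      (Complex.I • stdOrthonormalBasis ℂ V j) -
      (inner ℂ (stdOrthonormalBasis ℂ V j) x).im • stdOrthonormalBasis ℂ V j) := by
    conv_lhs => rw [← (stdOrthonormalBasis ℂ V).sum_repr' x, Finset.smul_sum]
    refine Finset.sum_congr rfl fun j _ => ?_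
    generalize inner ℂ (stdOrthonormalBasis ℂ V j) x = c
    rw [← Complex.coe_smul, ← Complex.coe_smul, smul_smul, smul_smul, ← sub_smul]
    congr 1
    apply Complex.ext <;> simp
  have hl : pullbackI V b x = b (Complex.I • x) := rfl
  rw [LinearMap.neg_apply, hl, hx, map_sum, LinearMap.smul_apply, LinearMap.sum_apply, smul_eq_mul,
    Finset.mul_sum, ← Finset.sum_neg_distrib]
  refine Finset.sum_congr rfl fun j _ => ?_
  simp only [pairing_coord, pairing_conjOne_coord]
  simp only [coord, LinearMap.sub_apply,
    LinearMap.smul_apply, LinearMap.coe_restrictScalars, conjOne_apply, innerₛₗ_apply_apply,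
    map_sub, map_smul, smul_eq_mul, Complex.real_smul]
  generalize inner ℂ (stdOrthonormalBasis ℂ V j) x = c
  generalize b (stdOrthonormalBasis ℂ V j) = s
  generalize b (Complex.I • stdOrthonormalBasis ℂ V j) = t
  have hc : starRingEnd ℂ c = c.re - c.im * Complex.I := by apply Complex.ext <;> simp
  rw [hc]
  conv_rhs => enter [2, 2, 2]; rw [← Complex.re_add_im c]
  ring_nf
  simp only [Complex.I_sq]
  ring

/-- The Leibniz rule applied to `ω` in coordinates yields exactly the sum in `pullbackI_eq_sum`.
This replaces coordinates by `J` in the later computations with `ω`. -/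
lemma intProd_fundamentalForm (a : OneForms V) :
    intProd a (fundamentalForm V) = -ExteriorAlgebra.ι ℂ (pullbackI V a) := by
  rw [← map_neg, pullbackI_eq_sum, fundamentalForm, map_smul, map_smul, map_sum, map_sum]
  congr 1
  refine Finset.sum_congr rfl fun j _ => ?_
  rw [intProd_ι_mul, intProd_ι, ← Algebra.commutes, ← Algebra.smul_def, map_sub, map_smul, map_smul,
    pairing_comm a, pairing_comm a]

lemma lefschetzAdjoint_eq_sum (x : Forms V) :
    lefschetzAdjoint V x = (Complex.I / 2) •
      ∑ j, intProd (conjOne (coord V j)) (intProd (coord V j) x) := by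
  simp only [lefschetzAdjoint, fundamentalForm, map_smul, map_sum, map_mul, MulOpposite.unop_smul,
    Finset.unop_sum, MulOpposite.unop_mul, LinearMap.smul_apply, LinearMap.sum_apply]
  simp only [Module.End.mul_apply, contraction_ι]
  rfl

/-- `Λ` is a sum of double contractions. Moving both contractions past `b` restores the sign of `b ∧
Λ x` and leaves single contractions, whose coefficients are those of `pullbackI_eq_sum`. -/
lemma lefschetzAdjoint_ι_mul (b : OneForms V) (x : Forms V) :
    lefschetzAdjoint V (ExteriorAlgebra.ι ℂ b * x) =
      ExteriorAlgebra.ι ℂ b * lefschetzAdjoint V x - intProd (pullbackI V b) x := by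
  have h : intProd (pullbackI V b) x = -intProd (-pullbackI V b) x := by simp [intProd_neg]
  rw [h, pullbackI_eq_sum, intProd_smul, intProd_sum, lefschetzAdjoint_eq_sum,
    lefschetzAdjoint_eq_sum, LinearMap.smul_apply, LinearMap.sum_apply, mul_smul_comm,
    Finset.mul_sum, sub_neg_eq_add, ← smul_add, ← Finset.sum_add_distrib]
  congr 1
  refine Finset.sum_congr rfl fun j _ => ?_
  rw [intProd_ι_mul, map_sub, map_smul, intProd_ι_mul, sub_eq_add_neg (pairing V _ b • conjOne _),
    ← neg_smul, intProd_add, intProd_smul, intProd_smul]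
  simp only [LinearMap.add_apply, LinearMap.smul_apply, neg_smul]
  abel

lemma intProd_lefschetzAdjoint (a : OneForms V) (x : Forms V) :
    intProd a (lefschetzAdjoint V x) = lefschetzAdjoint V (intProd a x) := by
  simp only [lefschetzAdjoint_eq_sum, map_smul, map_sum]
  congr 1
  refine Finset.sum_congr rfl fun j _ => ?_
  rw [intProd_comm a, intProd_comm a, map_neg, neg_neg]

lemma gradeInvolution_lefschetzAdjoint (x : Forms V) :
    gradeInvolution V (lefschetzAdjoint V x) = lefschetzAdjoint V (gradeInvolution V x) := by
  simp only [lefschetzAdjoint_eq_sum, map_smul, map_sum, intProd_gradeInvolution, map_neg, neg_neg]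

lemma conjForm_intProd (a : OneForms V) (x : Forms V) :
    conjForm V (intProd a x) = intProd (conjOne a) (conjForm V x) := by
  induction x using forms_induction with
  | algebraMap r => simp [conjForm_algebraMap]
  | add x y hx hy => simp only [map_add, hx, hy]
  | ι_mul b x hx =>
    simp only [intProd_ι_mul, map_sub, conjForm_smul, map_mul, conjForm_ι, hx, pairing_conjOne]

/-- `Λ` is real: conjugation exchanges the two contractions in each summand, and the resulting sign
cancels the one from conjugating `i / 2`. -/
lemma conjForm_lefschetzAdjoint (x : Forms V) :
    conjForm V (lefschetzAdjoint V x) = lefschetzAdjoint V (conjForm V x) := by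
  have h : ∀ α : OneForms V, conjOne (conjOne α) = α := by intro α; ext x; simp
  have h2 : starRingEnd ℂ (2 : ℂ) = 2 := Complex.conj_ofNat 2
  simp only [lefschetzAdjoint_eq_sum, conjForm_smul, map_sum, conjForm_intProd, h, map_div₀,
    Complex.conj_I, h2, Finset.smul_sum]
  refine Finset.sum_congr rfl fun j _ => ?_
  rw [intProd_comm, neg_div, neg_smul_neg]

lemma lefschetzAdjoint_mem {r : ℕ} {x : Forms V} (hx : x ∈ ⋀[ℂ]^(r + 2) (OneForms V)) :
    lefschetzAdjoint V x ∈ ⋀[ℂ]^r (OneForms V) := by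
  rw [lefschetzAdjoint_eq_sum]
  exact Submodule.smul_mem _ _ (Submodule.sum_mem _ fun j _ =>
    intProd_mem_exteriorPower _ (intProd_mem_exteriorPower _ hx))

lemma lefschetzAdjoint_eq_zero {r : ℕ} (hr : r < 2) {x : Forms V}
    (hx : x ∈ ⋀[ℂ]^r (OneForms V)) : lefschetzAdjoint V x = 0 := by
  rw [lefschetzAdjoint_eq_sum, Finset.sum_eq_zero, smul_zero]
  intro j _
  obtain rfl | rfl : r = 0 ∨ r = 1 := by omega
  · rw [intProd_eq_zero _ hx, map_zero]
  · exact intProd_eq_zero _ (intProd_mem_exteriorPower _ hx)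

end Contraction

/-! ### Divided powers of `ω` and `Λ`, top-degree forms, and the exponential of `Λ`. -/

section Lefschetz

lemma smul_dividedPower_succ {A : Type*} [Ring A] [Algebra ℂ A] (a : A) (m : ℕ) :
    (m + 1 : ℂ) • dividedPower a ((m + 1 : ℕ) : ℤ) = a * dividedPower a (m : ℤ) := by
  rw [dividedPower_succ, smul_inv_smul₀ (Nat.cast_add_one_ne_zero m)]

variable {V : Type*} [NormedAddCommGroup V] [InnerProductSpace ℂ V] [FiniteDimensional ℂ V]

lemma fundamentalForm_pow_mem (m : ℕ) :
    fundamentalForm V ^ m ∈ ⋀[ℂ]^(2 * m) (OneForms V) := by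
  rw [ExteriorAlgebra.exteriorPower, pow_mul]
  exact Submodule.pow_mem_pow _ fundamentalForm_mem_exteriorPower m

lemma dividedPower_fundamentalForm_mem (m : ℕ) :
    dividedPower (fundamentalForm V) (m : ℤ) ∈ ⋀[ℂ]^(2 * m) (OneForms V) :=
  Submodule.smul_mem _ _ (fundamentalForm_pow_mem m)

lemma fundamentalForm_mul_comm (x : Forms V) :
    fundamentalForm V * x = x * fundamentalForm V := by
  induction x using forms_induction with
  | algebraMap r => exact (Algebra.commutes _ _).symm
  | add x y hx hy => rw [mul_add, add_mul, hx, hy]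
  | ι_mul a x hx =>
    rw [← mul_assoc, mul_ι_eq, gradeInvolution_fundamentalForm, mul_assoc, hx, mul_assoc]

/-- Contraction is a derivation on the powers of the even element `ω`, and divided powers absorb the
numerical factor it produces. -/
lemma intProd_dividedPower_fundamentalForm (a : OneForms V) (m : ℕ) :
    intProd a (dividedPower (fundamentalForm V) ((m + 1 : ℕ) : ℤ)) =
      -(ExteriorAlgebra.ι ℂ (pullbackI V a) * dividedPower (fundamentalForm V) (m : ℤ)) := by
  induction m with
  | zero =>
    rw [dividedPower_succ]
    simp [intProd_fundamentalForm]
  | succ m ih =>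
    have h : ((m + 1 : ℕ) + 1 : ℂ) ≠ 0 := Nat.cast_add_one_ne_zero _
    -- Multiplying by `m + 2` clears the new factorial denominator, so that the recursion for
    -- divided powers applies.
    refine smul_right_injective _ h ?_
    simp only
    rw [← map_smul, smul_dividedPower_succ, intProd_mul, intProd_fundamentalForm,
      gradeInvolution_fundamentalForm, ih, mul_neg, ← mul_assoc, fundamentalForm_mul_comm,
      mul_assoc, ← smul_dividedPower_succ, mul_smul_comm, neg_mul]
    push_cast
    module

lemma lefschetzAdjoint_pow (m : ℕ) :
    lefschetzAdjoint V ^ m = (contraction V (fundamentalForm V ^ m)).unop := by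
  rw [map_pow, MulOpposite.unop_pow]
  rfl

/-- `Λ^m` is contraction by `ω^m`, which vanishes because its degree `2m` exceeds `2n`. -/
lemma dividedPower_lefschetzAdjoint_eq_zero {m : ℕ} (hm : finrank ℂ V < m) :
    dividedPower (lefschetzAdjoint V) (m : ℤ) = 0 := by
  rw [dividedPower_natCast, lefschetzAdjoint_pow,
    exteriorPower_eq_zero (by omega) (fundamentalForm_pow_mem m), map_zero, MulOpposite.unop_zero,
    smul_zero]

lemma smul_dividedPower_lefschetzAdjoint_succ (m : ℕ) (x : Forms V) :
    (m + 1 : ℂ) • dividedPower (lefschetzAdjoint V) ((m + 1 : ℕ) : ℤ) x =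
      lefschetzAdjoint V (dividedPower (lefschetzAdjoint V) (m : ℤ) x) := by
  rw [← LinearMap.smul_apply, smul_dividedPower_succ]
  rfl

lemma dividedPower_lefschetzAdjoint_succ (m : ℕ) (x : Forms V) :
    dividedPower (lefschetzAdjoint V) ((m + 1 : ℕ) : ℤ) x =
      (m + 1 : ℂ)⁻¹ • lefschetzAdjoint V (dividedPower (lefschetzAdjoint V) (m : ℤ) x) := by
  rw [dividedPower_succ]
  rfl

/-- The commutator `-i_{J b}` of `Λ` with `b ∧ ·` commutes with `Λ` itself, so iterating produces
only first-order terms. -/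
lemma dividedPower_lefschetzAdjoint_ι_mul (b : OneForms V) (m : ℕ) (x : Forms V) :
    dividedPower (lefschetzAdjoint V) ((m + 1 : ℕ) : ℤ) (ExteriorAlgebra.ι ℂ b * x) =
      ExteriorAlgebra.ι ℂ b * dividedPower (lefschetzAdjoint V) ((m + 1 : ℕ) : ℤ) x -
        intProd (pullbackI V b) (dividedPower (lefschetzAdjoint V) (m : ℤ) x) := by
  induction m with
  | zero =>
    rw [dividedPower_lefschetzAdjoint_succ, dividedPower_lefschetzAdjoint_succ]
    simp [lefschetzAdjoint_ι_mul]
  | succ m ih =>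
    have h : ((m + 1 : ℕ) + 1 : ℂ) ≠ 0 := Nat.cast_add_one_ne_zero _
    refine smul_right_injective _ h ?_
    simp only
    rw [smul_dividedPower_lefschetzAdjoint_succ, ih, map_sub, lefschetzAdjoint_ι_mul,
      ← intProd_lefschetzAdjoint, ← smul_dividedPower_lefschetzAdjoint_succ m,
      ← smul_dividedPower_lefschetzAdjoint_succ, mul_smul_comm, map_smul]
    push_cast
    module

lemma intProd_dividedPower_lefschetzAdjoint (a : OneForms V) (m : ℕ) (x : Forms V) :
    intProd a (dividedPower (lefschetzAdjoint V) (m : ℤ) x) =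
      dividedPower (lefschetzAdjoint V) (m : ℤ) (intProd a x) := by
  induction m with
  | zero => simp
  | succ m ih =>
    rw [dividedPower_lefschetzAdjoint_succ, dividedPower_lefschetzAdjoint_succ, map_smul,
      intProd_lefschetzAdjoint, ih]

lemma gradeInvolution_dividedPower_lefschetzAdjoint (m : ℕ) (x : Forms V) :
    gradeInvolution V (dividedPower (lefschetzAdjoint V) (m : ℤ) x) =
      dividedPower (lefschetzAdjoint V) (m : ℤ) (gradeInvolution V x) := by
  induction m with
  | zero => simp
  | succ m ih =>
    rw [dividedPower_lefschetzAdjoint_succ, dividedPower_lefschetzAdjoint_succ, map_smul,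
      gradeInvolution_lefschetzAdjoint, ih]

lemma conjForm_dividedPower_lefschetzAdjoint (m : ℕ) (x : Forms V) :
    conjForm V (dividedPower (lefschetzAdjoint V) (m : ℤ) x) =
      dividedPower (lefschetzAdjoint V) (m : ℤ) (conjForm V x) := by
  induction m with
  | zero => simp
  | succ m ih =>
    rw [dividedPower_lefschetzAdjoint_succ, dividedPower_lefschetzAdjoint_succ, conjForm_smul,
      conjForm_lefschetzAdjoint, ih]
    simp

lemma dividedPower_lefschetzAdjoint_mem {r m : ℕ} (hm : 2 * m ≤ r) {x : Forms V}
    (hx : x ∈ ⋀[ℂ]^r (OneForms V)) :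
    dividedPower (lefschetzAdjoint V) (m : ℤ) x ∈ ⋀[ℂ]^(r - 2 * m) (OneForms V) := by
  induction m with
  | zero => simpa using hx
  | succ m ih =>
    rw [dividedPower_lefschetzAdjoint_succ]
    refine Submodule.smul_mem _ _ (lefschetzAdjoint_mem ?_)
    rw [show r - 2 * (m + 1) + 2 = r - 2 * m by omega]
    exact ih (by omega)

lemma dividedPower_lefschetzAdjoint_apply_eq_zero {r m : ℕ} (hm : r < 2 * m) {x : Forms V}
    (hx : x ∈ ⋀[ℂ]^r (OneForms V)) :
    dividedPower (lefschetzAdjoint V) (m : ℤ) x = 0 := by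
  induction m with
  | zero => omega
  | succ m ih =>
    rw [dividedPower_lefschetzAdjoint_succ]
    by_cases h : r < 2 * m
    · rw [ih h, map_zero, smul_zero]
    · rw [lefschetzAdjoint_eq_zero (r := r - 2 * m) (by omega)
        (dividedPower_lefschetzAdjoint_mem (by omega) hx), smul_zero]

lemma dividedPower_lefschetzAdjoint_algebraMap (m : ℕ) (c : ℂ) :
    dividedPower (lefschetzAdjoint V) ((m + 1 : ℕ) : ℤ) (algebraMap ℂ (Forms V) c) = 0 :=
  dividedPower_lefschetzAdjoint_apply_eq_zero (r := 0) (by omega)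
    (algebraMap_mem_exteriorPower_zero c)

/-- The top-degree form `x ∧ ω ^ [n - k]` in terms of the iterated contraction of `x` by `ω`. -/
lemma mul_dividedPower_fundamentalForm {j k : ℕ} (hjk : j + k = finrank ℂ V) {x : Forms V}
    (hx : x ∈ ⋀[ℂ]^(2 * k) (OneForms V)) :
    x * dividedPower (fundamentalForm V) (j : ℤ) =
      (ExteriorAlgebra.algebraMapInv (dividedPower (lefschetzAdjoint V) (k : ℤ) x) : ℂ) •
        dividedPower (fundamentalForm V) (finrank ℂ V : ℤ) := by
  induction k generalizing j x with
  | zero =>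
    obtain rfl : j = finrank ℂ V := by omega
    obtain ⟨c, rfl⟩ := Submodule.mem_one.1 (by simpa using hx)
    rw [← Algebra.smul_def]
    simp
  | succ k ih =>
    generalize hr : 2 * (k + 1) = r at hx
    -- A form of degree `2k + 2` is reduced to products `a ∧ y` with `y` of degree `2k + 1`.
    induction hx using exteriorPower_induction with
    | algebraMap c => omega
    | add r x y _ _ hx hy => rw [add_mul, hx hr, hy hr, map_add, map_add, add_smul]
    | ι_mul a r y hy _ =>
      obtain rfl : r = 2 * k + 1 := by omega
      -- This product has degree `2n + 1`. Contracting it by `J a` gives `a ∧ y ∧ ω^[j] = -(i_{J a}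
      -- y) ∧ ω^[j+1]`, and the right side has degree `2k` in its first factor, where the induction
      -- hypothesis applies.
      have h0 : y * dividedPower (fundamentalForm V) ((j + 1 : ℕ) : ℤ) = 0 :=
        exteriorPower_eq_zero (by omega)
          (mem_exteriorPower_mul hy (dividedPower_fundamentalForm_mem (j + 1)))
      have h1 := congrArg (intProd (pullbackI V a)) h0
      rw [intProd_mul, intProd_dividedPower_fundamentalForm, pullbackI_pullbackI,
        ih (by omega) (intProd_mem_exteriorPower _ hy), map_neg, neg_mul, neg_neg, ← mul_assoc,
        mul_ι_eq, gradeInvolution_gradeInvolution, map_zero] at h1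
      rw [dividedPower_lefschetzAdjoint_ι_mul, map_sub, algebraMapInv_ι_mul, zero_sub,
        intProd_dividedPower_lefschetzAdjoint, neg_smul]
      exact eq_neg_of_add_eq_zero_right h1

variable (V) in
/-- The exponential of `Λ`. -/
def expAdjoint : Module.End ℂ (Forms V) :=
  ∑ m ∈ Finset.range (finrank ℂ V + 1), dividedPower (lefschetzAdjoint V) (m : ℤ)

lemma expAdjoint_apply (x : Forms V) : expAdjoint V x =
    ∑ m ∈ Finset.range (finrank ℂ V + 1), dividedPower (lefschetzAdjoint V) (m : ℤ) x := by
  rw [expAdjoint, LinearMap.sum_apply]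

lemma expAdjoint_algebraMap (c : ℂ) :
    expAdjoint V (algebraMap ℂ (Forms V) c) = algebraMap ℂ (Forms V) c := by
  rw [expAdjoint_apply, Finset.sum_range_succ']
  simp only [dividedPower_lefschetzAdjoint_algebraMap]
  simp

lemma gradeInvolution_expAdjoint (x : Forms V) :
    gradeInvolution V (expAdjoint V x) = expAdjoint V (gradeInvolution V x) := by
  simp only [expAdjoint_apply, map_sum, gradeInvolution_dividedPower_lefschetzAdjoint]

/-- Conjugation by `exp Λ` turns the operator `b ∧ ·` into `b ∧ · - i_{J b}`. -/
lemma expAdjoint_ι_mul (b : OneForms V) (x : Forms V) :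
    expAdjoint V (ExteriorAlgebra.ι ℂ b * x) =
      ExteriorAlgebra.ι ℂ b * expAdjoint V x - intProd (pullbackI V b) (expAdjoint V x) := by
  -- The index shift leaves the boundary term `i_{J b} Λ^[n] x`. It is zero because `Λ^[n+1] = 0`,
  -- so truncating the exponential at `n` loses nothing.
  have h0 := dividedPower_lefschetzAdjoint_ι_mul b (finrank ℂ V) x
  rw [dividedPower_lefschetzAdjoint_eq_zero (Nat.lt_succ_self _)] at h0
  simp only [LinearMap.zero_apply, mul_zero, zero_sub, zero_eq_neg] at h0
  rw [expAdjoint_apply, Finset.sum_range_succ']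
  simp only [dividedPower_lefschetzAdjoint_ι_mul, Finset.sum_sub_distrib, ← Finset.mul_sum]
  rw [expAdjoint_apply]
  conv_rhs => enter [1, 2]; rw [Finset.sum_range_succ']
  rw [Finset.sum_range_succ, map_add, h0, map_sum, mul_add]
  simp
  abel

end Lefschetz

/-! ### Wick's formula and the passage to the Hermitian inner product. -/

section Wick

variable {V : Type*} [NormedAddCommGroup V] [InnerProductSpace ℂ V] [FiniteDimensional ℂ V]

variable (V) in
/-- The action of forms on forms extending the negative of the contraction by one-forms. -/
def negContraction : Forms V →ₐ[ℂ] Module.End ℂ (Forms V) :=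
  ExteriorAlgebra.lift ℂ
    ⟨-((CliffordAlgebra.contractLeft (Q := (0 : QuadraticForm ℂ (OneForms V)))) ∘ₗ pairing V),
      fun a => LinearMap.ext fun x => by
        simpa using CliffordAlgebra.contractLeft_contractLeft (pairing V a) x⟩

lemma negContraction_ι (a : OneForms V) :
    negContraction V (ExteriorAlgebra.ι ℂ a) = -intProd a := by
  rw [negContraction, ExteriorAlgebra.lift_ι_apply]
  rfl

lemma negContraction_ι_mul (a : OneForms V) (y x : Forms V) :
    negContraction V (ExteriorAlgebra.ι ℂ a * y) x = -intProd a (negContraction V y x) := by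
  rw [map_mul, negContraction_ι]
  rfl

lemma negContraction_algebraMap (c : ℂ) (x : Forms V) :
    negContraction V (algebraMap ℂ (Forms V) c) x = c • x := by
  rw [AlgHom.commutes]
  rfl

/-- Contractions anticommute, so `i_a` acquires one sign for each one-form factor of `y`. -/
lemma intProd_negContraction (a : OneForms V) (y x : Forms V) :
    intProd a (negContraction V y x) = negContraction V (gradeInvolution V y) (intProd a x) := by
  induction y using forms_induction with
  | algebraMap r => simp
  | add y z hy hz => simp only [map_add, LinearMap.add_apply, hy, hz]
  | ι_mul b y hy =>
    rw [negContraction_ι_mul, map_neg, intProd_comm, hy, map_mul, gradeInvolution_ι, neg_mul,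
      map_neg, LinearMap.neg_apply, negContraction_ι_mul]

lemma negContraction_gradeInvolution (y x : Forms V) :
    negContraction V y (gradeInvolution V x) =
      gradeInvolution V (negContraction V (gradeInvolution V y) x) := by
  induction y using forms_induction with
  | algebraMap r => simp
  | add y z hy hz => simp only [map_add, LinearMap.add_apply, hy, hz]
  | ι_mul b y hy =>
    rw [negContraction_ι_mul, hy, intProd_gradeInvolution, neg_neg, map_mul, gradeInvolution_ι,
      neg_mul, map_neg, LinearMap.neg_apply, negContraction_ι_mul, neg_neg]

/-- Either no factor of `y` meets `b`, which then stays outside, or one factor is paired with `b`;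
by symmetry of the pairing the latter removes that factor from `y` through `i_b`. -/
lemma negContraction_mul_ι (b : OneForms V) (y x : Forms V) :
    negContraction V y (ExteriorAlgebra.ι ℂ b * x) =
      ExteriorAlgebra.ι ℂ b * negContraction V (gradeInvolution V y) x -
        negContraction V (gradeInvolution V (intProd b y)) x := by
  induction y using forms_induction with
  | algebraMap r => simp
  | add y z hy hz => simp only [map_add, LinearMap.add_apply, hy, hz, mul_add]; abel
  | ι_mul c y hy =>
    simp only [negContraction_ι_mul, hy, map_sub, intProd_ι_mul, map_mul (gradeInvolution V), gradeInvolution_ι,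
      neg_mul, map_neg, LinearMap.neg_apply, LinearMap.sub_apply, map_smul, LinearMap.smul_apply,
      pairing_comm c b, mul_neg]
    abel

/-- Wick's formula: the full contraction by `ω` of a product. -/
lemma algebraMapInv_expAdjoint_mul_weil (u w : Forms V) :
    (ExteriorAlgebra.algebraMapInv (expAdjoint V (u * weil V w)) : ℂ) =
      ExteriorAlgebra.algebraMapInv (negContraction V (expAdjoint V w) (expAdjoint V u)) := by
  -- `u` must vary: each one-form split off from `w` is transferred to `u`.
  induction w using forms_induction generalizing u with
  | algebraMap r =>
    rw [AlgHom.commutes, ← Algebra.commutes, ← Algebra.smul_def, map_smul, expAdjoint_algebraMap,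
      negContraction_algebraMap]
  | add x y hx hy => simp only [map_add, mul_add, LinearMap.add_apply, hx, hy]
  | ι_mul a w hw =>
    -- The factor `J a` moves to the front of `u`, where `exp Λ` turns it into `J a ∧ · + i_a`,
    -- since `J² a = -a`. In the scalar part, `J a ∧ ·` can only be paired with `exp Λ w`, which
    -- matches the `-i_{J a}` in `exp Λ (a ∧ w)`; the term `i_a` matches the action of `a` in
    -- `negContraction`.
    rw [map_mul (weil V), weil_ι, ← mul_assoc, mul_ι_eq, hw, expAdjoint_ι_mul, expAdjoint_ι_mul,
      pullbackI_pullbackI, ← gradeInvolution_expAdjoint, map_sub, map_sub, map_sub,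
      LinearMap.sub_apply, map_sub, negContraction_mul_ι, map_sub, algebraMapInv_ι_mul,
      ← gradeInvolution_gradeInvolution (intProd _ (expAdjoint V w)),
      negContraction_ι_mul, intProd_neg, LinearMap.neg_apply, intProd_gradeInvolution, neg_neg,
      negContraction_gradeInvolution, gradeInvolution_gradeInvolution,
      negContraction_gradeInvolution, intProd_negContraction]
    simp
    abel

/-- The `r` factors contribute `(-1)^r`. The two actions also compose the contractions in opposite
orders, and reversing them costs `(-1)^(r(r-1)/2)`. -/
lemma negContraction_eq_contraction {r : ℕ} {y : Forms V} (hy : y ∈ ⋀[ℂ]^r (OneForms V)) :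
    negContraction V y = (-1 : ℂ) ^ (r * (r + 1) / 2) • (contraction V y).unop := by
  induction hy using exteriorPower_induction with
  | algebraMap c => simp
  | add r x y _ _ hx hy => simp [hx, hy]
  | ι_mul a r y hy ih =>
    have h2 : (r + 1) * (r + 1 + 1) / 2 = r * (r + 1) / 2 + (r + 1) := by
      rw [show (r + 1) * (r + 1 + 1) = r * (r + 1) + (r + 1) * 2 by ring,
        Nat.add_mul_div_right _ _ two_pos]
    refine LinearMap.ext fun x => ?_
    rw [negContraction_ι_mul, intProd_negContraction, gradeInvolution_of_mem hy, map_smul, ih,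
      LinearMap.smul_apply, LinearMap.smul_apply, LinearMap.smul_apply, contraction_mul,
      contraction_ι, smul_smul, h2, pow_add, pow_succ, ← neg_smul]
    congr 1
    ring

lemma formInner_eq_zero {r s : ℕ} (h : r ≠ s) {x y : Forms V} (hx : x ∈ ⋀[ℂ]^r (OneForms V))
    (hy : y ∈ ⋀[ℂ]^s (OneForms V)) : formInner x y = 0 := by
  rw [← ExteriorAlgebra.ιMulti_span_fixedDegree] at hx hy
  induction hx using Submodule.span_induction with
  | mem x hx =>
    obtain ⟨a, rfl⟩ := hx
    induction hy using Submodule.span_induction with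
    | mem y hy =>
      obtain ⟨b, rfl⟩ := hy
      exact formInner_ιMulti_of_ne h a b
    | zero => simp [formInner]
    | add y z _ _ hy hz => rw [formInner_add_right, hy, hz, add_zero]
    | smul c y _ hy => rw [formInner_smul_right, hy, mul_zero]
  | zero => simp [formInner]
  | add y z _ _ hy hz => rw [formInner_add_left, hy, hz, add_zero]
  | smul c y _ hy => rw [formInner_smul_left, hy, mul_zero]

/-- The full contraction by `ω` of `u ∧ conj (I v)`, for forms of the same degree. -/
lemma algebraMapInv_expAdjoint_mul_conjForm_weil {k : ℕ} {u v : Forms V}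
    (hu : u ∈ ⋀[ℂ]^k (OneForms V)) (hv : v ∈ ⋀[ℂ]^k (OneForms V)) :
    (-1 : ℂ) ^ (k * (k + 1) / 2) *
      ExteriorAlgebra.algebraMapInv (expAdjoint V (u * conjForm V (weil V v))) =
      ∑ m ∈ Finset.range (finrank ℂ V + 1), (-1 : ℂ) ^ m *
        formInner (dividedPower (lefschetzAdjoint V) (m : ℤ) u)
          (dividedPower (lefschetzAdjoint V) (m : ℤ) v) := by
  rw [conjForm_weil, algebraMapInv_expAdjoint_mul_weil, expAdjoint_apply (conjForm V v),
    map_sum, LinearMap.sum_apply, map_sum, Finset.mul_sum]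
  refine Finset.sum_congr rfl fun m hm => ?_
  rw [← conjForm_dividedPower_lefschetzAdjoint, expAdjoint_apply, map_sum, map_sum]
  by_cases hk : k < 2 * m
  · rw [dividedPower_lefschetzAdjoint_apply_eq_zero hk hv]
    simp [formInner]
  · have hv' := dividedPower_lefschetzAdjoint_mem (by omega) hv (m := m)
    rw [negContraction_eq_contraction (conjForm_mem_exteriorPower hv')]
    simp only [LinearMap.smul_apply, map_smul]
    -- The nonzero terms have degrees `k - 2i` and `k - 2m`, so only the diagonal term `i = m`
    -- survives.
    have hs : ∀ i ∈ Finset.range (finrank ℂ V + 1), i ≠ m →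
        formInner (dividedPower (lefschetzAdjoint V) (i : ℤ) u)
          (dividedPower (lefschetzAdjoint V) (m : ℤ) v) = 0 := by
      intro i _ him
      by_cases hi : k < 2 * i
      · rw [dividedPower_lefschetzAdjoint_apply_eq_zero hi hu]
        simp [formInner]
      · exact formInner_eq_zero (by omega) (dividedPower_lefschetzAdjoint_mem (by omega) hu) hv'
    rw [← Finset.smul_sum, smul_eq_mul, ← mul_assoc, ← pow_add]
    -- The scalar part of contraction by a conjugate form is `formInner` by definition.
    change _ * ∑ i ∈ Finset.range (finrank ℂ V + 1),
      formInner (dividedPower (lefschetzAdjoint V) (i : ℤ) u)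
        (dividedPower (lefschetzAdjoint V) (m : ℤ) v) = _
    rw [Finset.sum_eq_single_of_mem m hm hs]
    congr 1
    -- With `d` the degree of `Λ^[m] v`, the exponents `k(k+1)/2` and `d(d+1)/2` add up to `m`
    -- modulo 2.
    obtain ⟨d, rfl⟩ : ∃ d, k = d + 2 * m := ⟨k - 2 * m, by omega⟩
    rw [Nat.add_sub_cancel]
    have h1 : (d + 2 * m) * (d + 2 * m + 1) / 2 = d * (d + 1) / 2 + (2 * d * m + 2 * m * m + m) := by
      rw [show (d + 2 * m) * (d + 2 * m + 1) = d * (d + 1) + (2 * d * m + 2 * m * m + m) * 2 by ring,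
        Nat.add_mul_div_right _ _ two_pos]
    rw [h1, show ∀ e : ℕ, e + (2 * d * m + 2 * m * m + m) + e = 2 * (e + d * m + m * m) + m by
      intro e; ring, pow_add, pow_mul]
    simp

end Wick

end HermitianForms

end

/-! ### Comparison of the two evaluations. -/

theorem mainTheorem4 {V : Type*} [NormedAddCommGroup V] [InnerProductSpace ℂ V]
    [FiniteDimensional ℂ V] (n : ℕ) (hn : Module.finrank ℂ V = n) (p q k : ℕ) (hk : k = p + q)
    (u v : HermitianForms.Forms V)
    (hu : u ∈ HermitianForms.formsPQ V p q) (hv : v ∈ HermitianForms.formsPQ V p q) :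
    ((-1 : ℂ) ^ (k * (k + 1) / 2)) •
        (u * HermitianForms.conjForm V (HermitianForms.weil V v) *
          HermitianForms.dividedPower (HermitianForms.fundamentalForm V) ((n : ℤ) - (k : ℤ))) =
      ∑ m ∈ Finset.range (n + 1),
        ((-1 : ℂ) ^ m *
          HermitianForms.formInner
            (HermitianForms.dividedPower (HermitianForms.lefschetzAdjoint V) (m : ℤ) u)
            (HermitianForms.dividedPower (HermitianForms.lefschetzAdjoint V) (m : ℤ) v)) •
          HermitianForms.dividedPower (HermitianForms.fundamentalForm V) (n : ℤ) := by
  subst hn hk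
  have hu' := HermitianForms.formsPQ_le_exteriorPower p q hu
  have hv' := HermitianForms.formsPQ_le_exteriorPower p q hv
  have hx := HermitianForms.mem_exteriorPower_mul hu'
    (HermitianForms.conjForm_mem_exteriorPower (HermitianForms.weil_mem_exteriorPower hv'))
  rw [← Finset.sum_smul,
    ← HermitianForms.algebraMapInv_expAdjoint_mul_conjForm_weil hu' hv', mul_smul]
  congr 1
  generalize p + q = k at hx ⊢
  rw [← two_mul] at hx
  by_cases hk : k ≤ Module.finrank ℂ V
  · rw [← Nat.cast_sub hk,
      HermitianForms.mul_dividedPower_fundamentalForm (Nat.sub_add_cancel hk) hx,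
      HermitianForms.expAdjoint_apply, map_sum,
      -- Only `Λ^[k]` contributes to the scalar part: for `m < k` the degree `2k - 2m` stays
      -- positive, and for `m > k` the form is killed.
      Finset.sum_eq_single_of_mem k (Finset.mem_range_succ_iff.2 hk)]
    intro m _ hmk
    by_cases hm : 2 * k < 2 * m
    · rw [HermitianForms.dividedPower_lefschetzAdjoint_apply_eq_zero hm hx, map_zero]
    · have h := HermitianForms.dividedPower_lefschetzAdjoint_mem (by omega) hx (m := m)
      exact HermitianForms.algebraMapInv_eq_zero (by omega) h
  -- For `k > n` the product `u ∧ conj (I v)` has degree `2k > 2n`, so both sides vanish.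
  · rw [HermitianForms.exteriorPower_eq_zero (by omega) hx]
    simp
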